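/- Let $(X,b,\varrho)$ be a weighted graph: $X$ is a countable set, $b:X\times X\to[0,\infty)$ is symmetric with $b(x,x)=0$ and $\sum_{y\in X}b(x,y)<\infty$ for all $x\in X$, and $\varrho:X\to(0,\infty)$ is arbitrary (vertices may have infinitely many neighbours). Write $x\sim_b y$ if $b(x,y)>0$, and assume that $(X,b)$ is connected, i.e. any two vertices are joined by a finite path of edges. Let $E=\bigsqcup_{x\in X}E_x\to X$ be a Hermitian vector bundle of rank $d$, i.e. a family of $d$-dimensional complex vector spaces with scalar products $(\cdot,\cdot)_x$, let $|\cdot|$ also denote the operator norms on $\mathrm{End}(E_x)$, and let $\Gamma_{\mathsf L^2}(X,E;\mathrm d\mu_\varrho)$ be the Hilbert space of sections $f$ with $\sum_{x}|f(x)|_x^2\varrho(x)<\infty$, with scalar product $\langle f,g\rangle=\sum_{x}(f(x),g(x))_x\varrho(x)$. Let $\Phi$ be a unitary $b$-connection on $E$, i.e. a family of isomorphisms $\Phi_{x,y}:E_x\to E_y$, $x\sim_b y$, with $\Phi_{y,x}=\Phi_{x,y}^{-1}=\Phi_{x,y}^*$, and let $V$ be a section of $\mathrm{End}(E)$ which is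 pointwise self-adjoint with nonnegative eigenvalues. The form $$\tilde Q^\Phi_b(\psi_1,\psi_2)=\frac12\sum_{x\sim_b y}b(x,y)\big(\psi_1(x)-\Phi_{y,x}\psi_1(y),\,\psi_2(x)-\Phi_{y,x}\psi_2(y)\big)_x$$ on the finitely supported sections is closable in $\Gamma_{\mathsf L^2}(X,E;\mathrm d\mu_\varrho)$. Let $H^\Phi_{b,\varrho,V}$ be the operator associated with the form sum of its closure and of the form $(f,g)\mapsto\sum_x(f(x),V(x)g(x))_x\varrho(x)$, the latter with domain $\{f\in\Gamma_{\mathsf L^2}:\sum_x(f(x),V(x)f(x))_x\varrho(x)<\infty\}$; it is self-adjoint and $H^\Phi_{b,\varrho,V}+a$ has a bounded everywhere defined inverse for every $a>0$. Let $W=W_1+W_2$, where $W_1,W_2$ are pointwise self-adjoint sections of $\mathrm{End}(E)$ with $$\sum_{x\in X}|W_1(x)|^2+\sum_{x\in\{|W_2|>c\}}(1+\varrho(x))<\infty\quad\text{for all }c>0,$$ and let $\hat W$ be the maximally defined operator of multiplication by $W$, i.e. $\mathrm{Dom}(\hat W)=\{f\in\Gamma_{\mathsf L^2}: Wf\in\Gamma_{\mathsf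 L^2}\}$. Then for all $a>0$ the operator $\hat W(H^\Phi_{b,\varrho,V}+a)^{-1}$ is everywhere defined and compact in $\Gamma_{\mathsf L^2}(X,E;\mathrm d\mu_\varrho)$. -/

import Mathlib

open scoped ComplexConjugate
open Filter Topology

/-! ### Closed forms in a Hilbert space -/

/-- A symmetric nonnegative sesquilinear form in `H`, defined on a subspace `domain`,
antilinear in the first slot. -/
structure NonnegForm (H : Type*) [NormedAddCommGroup H] [InnerProductSpace ℂ H] where
  domain : Submodule ℂ H
  form : domain →ₗ⋆[ℂ] domain →ₗ[ℂ] ℂ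
  symm : ∀ u v, conj (form u v) = form v u
  nonneg : ∀ u, 0 ≤ (form u u).re

namespace NonnegForm

section

variable {H : Type*} [NormedAddCommGroup H] [InnerProductSpace ℂ H]

/-- `u n` is a Cauchy sequence with respect to the seminorm `q(u,u) ^ (1/2)`. -/
def FormCauchy (q : NonnegForm H) (u : ℕ → q.domain) : Prop :=
  ∀ ε : ℝ, 0 < ε → ∃ N, ∀ m ≥ N, ∀ n ≥ N, (q.form (u m - u n) (u m - u n)).re < ε

/-- `q` is closed: if `u n → u` in `H` and `u n` is `q`-Cauchy, then `u` is in the domain of `q`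
and `q(u n - u, u n - u) → 0`. -/
def IsClosed (q : NonnegForm H) : Prop :=
  ∀ (u : ℕ → q.domain) (x : H), Tendsto (fun n => (u n : H)) atTop (𝓝 x) → q.FormCauchy u →
    ∃ hx : x ∈ q.domain,
      Tendsto (fun n => (q.form (u n - ⟨x, hx⟩) (u n - ⟨x, hx⟩)).re) atTop (𝓝 0)

/-- `q'` is the closure of `q`: a closed extension of `q` in which the domain of `q` is dense
with respect to the form norm. -/
def IsClosure (q' q : NonnegForm H) : Prop :=
  q'.IsClosed ∧ ∃ h : q.domain ≤ q'.domain,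
    (∀ u v : q.domain,
      q'.form (Submodule.inclusion h u) (Submodule.inclusion h v) = q.form u v) ∧
    ∀ x : q'.domain, ∃ u : ℕ → q.domain,
      Tendsto (fun n => (u n : H)) atTop (𝓝 (x : H)) ∧
      Tendsto (fun n => (q'.form (Submodule.inclusion h (u n) - x)
        (Submodule.inclusion h (u n) - x)).re) atTop (𝓝 0)

open Classical in
/-- The closure of `q`, if it exists (otherwise `q` itself). -/
noncomputable def closure (q : NonnegForm H) : NonnegForm H :=
  if h : ∃ q' : NonnegForm H, q'.IsClosure q then h.choose else q

/-- The sum of two forms, on the intersection of their domains. -/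
noncomputable def add (q₁ q₂ : NonnegForm H) : NonnegForm H where
  domain := q₁.domain ⊓ q₂.domain
  form := LinearMap.mk₂'ₛₗ (starRingEnd ℂ) (RingHom.id ℂ)
    (fun u v => q₁.form ⟨u, u.2.1⟩ ⟨v, v.2.1⟩ + q₂.form ⟨u, u.2.2⟩ ⟨v, v.2.2⟩)
    (fun u u' v => by
      have h₁ := q₁.form.map_add ⟨u, u.2.1⟩ ⟨u', u'.2.1⟩
      have h₂ := q₂.form.map_add ⟨u, u.2.2⟩ ⟨u', u'.2.2⟩
      have e₁ := LinearMap.congr_fun h₁ ⟨v, v.2.1⟩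
      have e₂ := LinearMap.congr_fun h₂ ⟨v, v.2.2⟩
      simp only [LinearMap.add_apply, AddMemClass.mk_add_mk] at e₁ e₂
      simp only [Submodule.coe_add, e₁, e₂]
      ring)
    (fun c u v => by
      have h₁ := q₁.form.map_smulₛₗ c ⟨u, u.2.1⟩
      have h₂ := q₂.form.map_smulₛₗ c ⟨u, u.2.2⟩
      have e₁ := LinearMap.congr_fun h₁ ⟨v, v.2.1⟩
      have e₂ := LinearMap.congr_fun h₂ ⟨v, v.2.2⟩
      simp only [LinearMap.smul_apply, SetLike.mk_smul_mk] at e₁ e₂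
      simp only [Submodule.coe_smul, e₁, e₂, smul_add])
    (fun u v v' => by
      have e₁ := (q₁.form ⟨u, u.2.1⟩).map_add ⟨v, v.2.1⟩ ⟨v', v'.2.1⟩
      have e₂ := (q₂.form ⟨u, u.2.2⟩).map_add ⟨v, v.2.2⟩ ⟨v', v'.2.2⟩
      simp only [AddMemClass.mk_add_mk] at e₁ e₂
      simp only [Submodule.coe_add, e₁, e₂]
      ring)
    (fun c u v => by
      have e₁ := (q₁.form ⟨u, u.2.1⟩).map_smul c ⟨v, v.2.1⟩
      have e₂ := (q₂.form ⟨u, u.2.2⟩).map_smul c ⟨v, v.2.2⟩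
      simp only [SetLike.mk_smul_mk] at e₁ e₂
      simp only [Submodule.coe_smul, e₁, e₂, smul_add, RingHom.id_apply])
  symm u v := by
    simp only [LinearMap.mk₂'ₛₗ_apply, map_add, q₁.symm, q₂.symm]
  nonneg u := by
    simp only [LinearMap.mk₂'ₛₗ_apply, Complex.add_re]
    exact add_nonneg (q₁.nonneg _) (q₂.nonneg _)

/-- The graph of the operator associated with `q`: `(u, w)` belongs to it if `u` is in the domain
of `q` and `q(v, u) = ⟪v, w⟫` for all `v` in the domain of `q`. -/
def operatorGraph (q : NonnegForm H) : Submodule ℂ (H × H) where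
  carrier := {p | ∃ h : p.1 ∈ q.domain, ∀ v : q.domain,
    q.form v ⟨p.1, h⟩ = inner ℂ (v : H) p.2}
  zero_mem' := ⟨q.domain.zero_mem, fun v => by
    rw [Prod.snd_zero, inner_zero_right]
    exact (q.form v).map_zero⟩
  add_mem' := by
    rintro p p' ⟨h, hp⟩ ⟨h', hp'⟩
    refine ⟨q.domain.add_mem h h', fun v => ?_⟩
    have e := (q.form v).map_add ⟨p.1, h⟩ ⟨p'.1, h'⟩
    rw [hp, hp'] at e
    simpa [inner_add_right] using e
  smul_mem' := by
    rintro c p ⟨h, hp⟩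
    refine ⟨q.domain.smul_mem c h, fun v => ?_⟩
    have e := (q.form v).map_smul c ⟨p.1, h⟩
    rw [hp] at e
    simpa [inner_smul_right] using e

/-- The operator associated with a (densely defined, closed) form `q`. -/
noncomputable def operator (q : NonnegForm H) : H →ₗ.[ℂ] H :=
  q.operatorGraph.toLinearPMap

end

end NonnegForm

/-- `R` is the bounded inverse `(T + a)⁻¹` of `T + a : dom T → H`. -/
def IsBoundedInverseOfAdd {H : Type*} [NormedAddCommGroup H] [InnerProductSpace ℂ H]
    (T : H →ₗ.[ℂ] H) (a : ℝ) (R : H →L[ℂ] H) : Prop :=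
  (∀ f : H, ∃ h : R f ∈ T.domain, T ⟨R f, h⟩ + (a : ℂ) • R f = f) ∧
    ∀ u : T.domain, R (T u + (a : ℂ) • (u : H)) = u

/-! ### Weighted graphs and Hermitian bundles over them -/

/-- A weighted graph on the (countable) vertex set `X`. -/
structure WeightedGraph (X : Type*) where
  b : X → X → ℝ
  ρ : X → ℝ
  b_nonneg : ∀ x y, 0 ≤ b x y
  b_symm : ∀ x y, b x y = b y x
  b_self : ∀ x, b x x = 0
  b_summable : ∀ x, Summable (b x)
  ρ_pos : ∀ x, 0 < ρ x

namespace WeightedGraph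

section

variable {X : Type*}

/-- Any two vertices are joined by a finite path of edges. -/
def Connected (G : WeightedGraph X) : Prop :=
  ∀ x y, Relation.ReflTransGen (fun u v => 0 < G.b u v) x y

/-- The fiber `E x`, with the scalar product `ρ x * (·, ·)_x`. -/
def WFiber (_G : WeightedGraph X) (E : X → Type*) (x : X) : Type _ := E x

variable (G : WeightedGraph X) (E : X → Type*) [∀ x, NormedAddCommGroup (E x)]
  [∀ x, InnerProductSpace ℂ (E x)]

instance (x : X) : AddCommGroup (G.WFiber E x) := inferInstanceAs (AddCommGroup (E x))

instance (x : X) : Module ℂ (G.WFiber E x) := inferInstanceAs (Module ℂ (E x))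

/-- The weighted scalar product on the fiber at `x`. -/
noncomputable abbrev fiberCore (x : X) : InnerProductSpace.Core ℂ (G.WFiber E x) where
  inner u v := (G.ρ x : ℂ) * inner ℂ (show E x from u) (show E x from v)
  conj_inner_symm u v := by
    rw [map_mul, Complex.conj_ofReal]
    congr 1
    exact inner_conj_symm (𝕜 := ℂ) (show E x from u) (show E x from v)
  re_inner_nonneg u := by
    have h : 0 ≤ (inner ℂ (show E x from u) (show E x from u)).re :=
      inner_self_nonneg (𝕜 := ℂ) (x := show E x from u)
    have := mul_nonneg (G.ρ_pos x).le h
    simpa using this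
  add_left u v w := by
    rw [← mul_add]
    congr 1
    exact inner_add_left (𝕜 := ℂ) (show E x from u) (show E x from v) (show E x from w)
  smul_left u v c := by
    rw [mul_left_comm]
    congr 1
    exact inner_smul_left (𝕜 := ℂ) (show E x from u) (show E x from v) c
  definite u hu := by
    have h : inner ℂ (show E x from u) (show E x from u) = 0 :=
      (mul_eq_zero.mp hu).resolve_left (by exact_mod_cast (G.ρ_pos x).ne')
    exact (inner_self_eq_zero (𝕜 := ℂ) (x := show E x from u)).mp h

noncomputable instance (x : X) : NormedAddCommGroup (G.WFiber E x) :=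
  (G.fiberCore E x).toNormedAddCommGroup

noncomputable instance (x : X) : InnerProductSpace ℂ (G.WFiber E x) :=
  InnerProductSpace.ofCore (G.fiberCore E x).toCore

instance (x : X) [h : FiniteDimensional ℂ (E x)] : CompleteSpace (G.WFiber E x) :=
  haveI : FiniteDimensional ℂ (G.WFiber E x) := h
  FiniteDimensional.complete ℂ (G.WFiber E x)

/-- The Hilbert space of square integrable sections of `E` with respect to the measure with
weights `ρ`; its scalar product is `∑ x, (f x, g x)_x ρ x`, see `inner_eq` below. -/
abbrev L2 : Type _ := lp (G.WFiber E) 2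

end

section

variable {X : Type*} {G : WeightedGraph X} {E : X → Type*} [∀ x, NormedAddCommGroup (E x)]
  [∀ x, InnerProductSpace ℂ (E x)]

/-- The identity map from `E x` to `E x` with the weighted scalar product. -/
def toW (G : WeightedGraph X) (E : X → Type*) [∀ x, NormedAddCommGroup (E x)]
    [∀ x, InnerProductSpace ℂ (E x)] (x : X) : E x ≃ₗ[ℂ] G.WFiber E x :=
  LinearEquiv.refl ℂ (E x)

/-- The value at `x` of an `L²`-section, as an element of the fiber `E x`. -/
def val (f : G.L2 E) (x : X) : E x := (G.toW E x).symm (f x)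

theorem val_add (f g : G.L2 E) (x : X) : val (f + g) x = val f x + val g x := rfl

theorem val_smul (c : ℂ) (f : G.L2 E) (x : X) : val (c • f) x = c • val f x := rfl

theorem val_zero (x : X) : val (0 : G.L2 E) x = 0 := rfl

theorem inner_eq (f g : G.L2 E) :
    inner ℂ f g = ∑' x, (G.ρ x : ℂ) * inner ℂ (val f x) (val g x) := rfl

theorem norm_toW_sq (x : X) (u : E x) : ‖G.toW E x u‖ ^ 2 = G.ρ x * ‖u‖ ^ 2 := by
  have h : ‖G.toW E x u‖ ^ 2 = ((G.ρ x : ℂ) * inner ℂ u u).re :=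
    norm_sq_eq_re_inner (𝕜 := ℂ) (G.toW E x u)
  rw [h, Complex.re_ofReal_mul]
  congr 1
  exact (norm_sq_eq_re_inner (𝕜 := ℂ) u).symm

/-- A section is in `L2` iff `∑ x, |f x|² ρ x < ∞`. -/
theorem memL2_iff (f : ∀ x, E x) :
    Memℓp (fun x => G.toW E x (f x)) 2 ↔ Summable fun x => G.ρ x * ‖f x‖ ^ 2 := by
  rw [memℓp_gen_iff (by norm_num)]
  refine summable_congr fun x => ?_
  rw [show (2 : ENNReal).toReal = ((2 : ℕ) : ℝ) by norm_num, Real.rpow_natCast, norm_toW_sq]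

/-- The maximally defined multiplication operator by a section `W` of `End(E)`: its domain
consists of all `f` in `L2` such that `x ↦ W x (f x)` is in `L2`. -/
noncomputable def mulOp (G : WeightedGraph X) (W : ∀ x, E x →L[ℂ] E x) :
    G.L2 E →ₗ.[ℂ] G.L2 E where
  domain :=
    { carrier := {f | Memℓp (fun x => G.toW E x (W x (val f x))) 2}
      zero_mem' := by
        have h : (fun x => G.toW E x (W x (val (0 : G.L2 E) x))) = 0 := by
          funext x
          simp [val_zero]
        rw [Set.mem_ofPred_eq, h]
        exact zero_memℓp
      add_mem' := by
        intro f g hf hg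
        have h : (fun x => G.toW E x (W x (val (f + g) x))) =
            (fun x => G.toW E x (W x (val f x))) + fun x => G.toW E x (W x (val g x)) := by
          funext x
          simp [val_add]
        rw [Set.mem_ofPred_eq, h]
        exact Memℓp.add hf hg
      smul_mem' := by
        intro c f hf
        have h : (fun x => G.toW E x (W x (val (c • f) x))) =
            c • (fun x => G.toW E x (W x (val f x))) := by
          funext x
          simp [val_smul]
        rw [Set.mem_ofPred_eq, h]
        exact Memℓp.const_smul hf c }
  toFun :=
    { toFun := fun f => ⟨fun x => G.toW E x (W x (val (f : G.L2 E) x)), f.2⟩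
      map_add' := fun f g => by
        apply Subtype.ext
        funext x
        exact congrArg (G.toW E x) ((W x).map_add (val (f : G.L2 E) x) (val (g : G.L2 E) x))
      map_smul' := fun c f => by
        apply Subtype.ext
        funext x
        exact congrArg (G.toW E x) ((W x).map_smul c (val (f : G.L2 E) x)) }

/-! ### The form of a nonnegative potential -/

theorem potential_bound {F : Type*} [NormedAddCommGroup F] [InnerProductSpace ℂ F]
    {T : F →L[ℂ] F} (hT : T.IsPositive) (u v : F) :
    2 * ‖inner ℂ u (T v)‖ ≤ (inner ℂ u (T u)).re + (inner ℂ v (T v)).re := by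
  obtain ⟨c, hc, hcv⟩ : ∃ c : ℂ, ‖c‖ = 1 ∧ c * inner ℂ u (T v) = -(‖inner ℂ u (T v)‖ : ℂ) := by
    by_cases h : inner ℂ u (T v) = 0
    · exact ⟨1, by simp, by simp [h]⟩
    · have h' : (‖inner ℂ u (T v)‖ : ℂ) ≠ 0 := by simpa using h
      refine ⟨-(‖inner ℂ u (T v)‖ : ℂ) / inner ℂ u (T v), ?_, by field_simp⟩
      rw [norm_div, norm_neg, Complex.norm_real, norm_norm, div_self (by simpa using h)]
  have key : 0 ≤ (inner ℂ (u + c • v) (T (u + c • v))).re := hT.re_inner_nonneg_right (u + c • v)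
  have hs : inner ℂ v (T u) = conj (inner ℂ u (T v)) := by
    rw [inner_conj_symm]
    exact (hT.1 v u).symm
  have hcc : conj c * c = 1 := by
    rw [mul_comm, Complex.mul_conj, Complex.normSq_eq_norm_sq, hc]; simp
  have e : inner ℂ (u + c • v) (T (u + c • v)) =
      inner ℂ u (T u) + inner ℂ v (T v) + (c * inner ℂ u (T v) + conj (c * inner ℂ u (T v))) := by
    simp only [map_add, map_smul, inner_add_left, inner_add_right, inner_smul_left,
      inner_smul_right, hs, map_mul]
    linear_combination (inner ℂ v (T v)) * hcc
  rw [e, hcv] at key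
  simp at key
  linarith

theorem potential_add_le {F : Type*} [NormedAddCommGroup F] [InnerProductSpace ℂ F]
    {T : F →L[ℂ] F} (hT : T.IsPositive) (u v : F) :
    (inner ℂ (u + v) (T (u + v))).re ≤
      2 * ((inner ℂ u (T u)).re + (inner ℂ v (T v)).re) := by
  have h₁ := potential_bound hT u v
  have h₂ := potential_bound hT v u
  have h₃ := Complex.re_le_norm (inner ℂ u (T v))
  have h₄ := Complex.re_le_norm (inner ℂ v (T u))
  simp only [map_add, inner_add_left, inner_add_right, Complex.add_re]
  linarith

theorem potential_summable {V : ∀ x, E x →L[ℂ] E x} (hV : ∀ x, (V x).IsPositive)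
    {f g : G.L2 E} (hf : Summable fun x => G.ρ x * (inner ℂ (val f x) (V x (val f x))).re)
    (hg : Summable fun x => G.ρ x * (inner ℂ (val g x) (V x (val g x))).re) :
    Summable fun x => (G.ρ x : ℂ) * inner ℂ (val f x) (V x (val g x)) := by
  refine Summable.of_norm_bounded (hf.add hg) fun x => ?_
  rw [norm_mul, Complex.norm_real, Real.norm_of_nonneg (G.ρ_pos x).le, ← mul_add]
  refine mul_le_mul_of_nonneg_left ?_ (G.ρ_pos x).le
  have := potential_bound (hV x) (val f x) (val g x)
  have := norm_nonneg (inner ℂ (val f x) (V x (val g x)))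
  linarith

/-- The domain of the square root of the multiplication operator by `V ≥ 0`: all `f` in `L2` with
`∑ x, (f x, V x (f x))_x ρ x < ∞`. -/
def potentialDomain (G : WeightedGraph X) (V : ∀ x, E x →L[ℂ] E x)
    (hV : ∀ x, (V x).IsPositive) : Submodule ℂ (G.L2 E) where
  carrier := {f | Summable fun x => G.ρ x * (inner ℂ (val f x) (V x (val f x))).re}
  zero_mem' := by
    simp only [Set.mem_ofPred_eq, val_zero, inner_zero_left, Complex.zero_re, mul_zero]
    exact summable_zero
  add_mem' := by
    intro f g hf hg
    refine Summable.of_nonneg_of_le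
      (fun x => mul_nonneg (G.ρ_pos x).le ((hV x).re_inner_nonneg_right _))
      (fun x => ?_) ((hf.add hg).mul_left 2)
    have := mul_le_mul_of_nonneg_left
      (potential_add_le (hV x) (val f x) (val g x)) (G.ρ_pos x).le
    rw [val_add]
    linarith
  smul_mem' := by
    intro c f hf
    have h : (fun x => G.ρ x * (inner ℂ (val (c • f) x) (V x (val (c • f) x))).re) =
        fun x => ‖c‖ ^ 2 * (G.ρ x * (inner ℂ (val f x) (V x (val f x))).re) := by
      funext x
      rw [val_smul, map_smul, inner_smul_left, inner_smul_right, ← mul_assoc,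
        ← Complex.normSq_eq_conj_mul_self, Complex.re_ofReal_mul, Complex.normSq_eq_norm_sq]
      ring
    rw [Set.mem_ofPred_eq, h]
    exact hf.mul_left _

/-- `∑ x, (f x, V x (g x))_x ρ x`. -/
noncomputable def potentialSum (V : ∀ x, E x →L[ℂ] E x) (f g : G.L2 E) : ℂ :=
  ∑' x, (G.ρ x : ℂ) * inner ℂ (val f x) (V x (val g x))

theorem potentialSum_symm {V : ∀ x, E x →L[ℂ] E x} (hV : ∀ x, (V x).IsPositive)
    (f g : G.L2 E) : conj (potentialSum V f g) = potentialSum V g f := by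
  unfold potentialSum
  rw [Complex.conj_tsum]
  refine tsum_congr fun x => ?_
  rw [map_mul, Complex.conj_ofReal, inner_conj_symm]
  congr 1
  exact (hV x).1 _ _

theorem potentialSum_add_right {V : ∀ x, E x →L[ℂ] E x} (hV : ∀ x, (V x).IsPositive)
    (f g g' : G.potentialDomain V hV) :
    potentialSum V (f : G.L2 E) ((g : G.L2 E) + g') =
      potentialSum V (f : G.L2 E) g + potentialSum V (f : G.L2 E) g' := by
  unfold potentialSum
  rw [← (potential_summable hV f.2 g.2).tsum_add (potential_summable hV f.2 g'.2)]
  refine tsum_congr fun x => ?_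
  rw [val_add, map_add, inner_add_right, mul_add]

theorem potentialSum_smul_right (V : ∀ x, E x →L[ℂ] E x) (c : ℂ) (f g : G.L2 E) :
    potentialSum V f (c • g) = c * potentialSum V f g := by
  unfold potentialSum
  rw [← tsum_mul_left]
  refine tsum_congr fun x => ?_
  rw [val_smul, map_smul, inner_smul_right, mul_left_comm]

theorem potentialSum_nonneg {V : ∀ x, E x →L[ℂ] E x} (hV : ∀ x, (V x).IsPositive)
    (f : G.potentialDomain V hV) : 0 ≤ (potentialSum V (f : G.L2 E) f).re := by
  unfold potentialSum
  rw [Complex.re_tsum (potential_summable hV f.2 f.2)]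
  refine tsum_nonneg fun x => ?_
  rw [Complex.re_ofReal_mul]
  exact mul_nonneg (G.ρ_pos x).le ((hV x).re_inner_nonneg_right _)

/-- The form of the multiplication operator by a section `V ≥ 0` of `End(E)`. -/
noncomputable def potentialForm (G : WeightedGraph X) (V : ∀ x, E x →L[ℂ] E x)
    (hV : ∀ x, (V x).IsPositive) : NonnegForm (G.L2 E) where
  domain := G.potentialDomain V hV
  form := LinearMap.mk₂'ₛₗ (starRingEnd ℂ) (RingHom.id ℂ)
    (fun f g => potentialSum V (f : G.L2 E) g)
    (fun f f' g => by
      have h := congrArg (starRingEnd ℂ) (potentialSum_add_right hV g f f')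
      simp only [map_add, potentialSum_symm hV] at h
      exact h)
    (fun c f g => by
      have h := congrArg (starRingEnd ℂ) (potentialSum_smul_right V c (g : G.L2 E) f)
      simp only [map_mul, potentialSum_symm hV] at h
      exact h)
    (fun f g g' => potentialSum_add_right hV f g g')
    (fun c f g => potentialSum_smul_right V c _ _)
  symm f g := potentialSum_symm hV _ _
  nonneg f := potentialSum_nonneg hV f

/-! ### Unitary connections and the covariant form -/

/-- A `b`-connection on `E`: an isomorphism `E x ≃ E y` for every edge `x ∼ y`, inverse to the
one for the edge `y ∼ x`. -/
structure Connection (G : WeightedGraph X) (E : X → Type*) [∀ x, NormedAddCommGroup (E x)]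
    [∀ x, InnerProductSpace ℂ (E x)] where
  iso : ∀ x y, 0 < G.b x y → (E x ≃ₗ[ℂ] E y)
  iso_symm : ∀ x y (h : 0 < G.b x y) (h' : 0 < G.b y x), iso y x h' = (iso x y h).symm

namespace Connection

/-- The adjoint of `Φ_{x,y}` is its inverse, for every edge `x ∼ y`. -/
def IsUnitary [∀ x, FiniteDimensional ℂ (E x)] (Φ : G.Connection E) : Prop :=
  ∀ x y (h : 0 < G.b x y),
    LinearMap.adjoint (Φ.iso x y h : E x →ₗ[ℂ] E y) = ((Φ.iso x y h).symm : E y →ₗ[ℂ] E x)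

theorem IsUnitary.norm_iso [∀ x, FiniteDimensional ℂ (E x)] {Φ : G.Connection E}
    (hΦ : Φ.IsUnitary) (x y : X) (h : 0 < G.b x y) (u : E x) : ‖Φ.iso x y h u‖ = ‖u‖ := by
  have e : inner ℂ (Φ.iso x y h u) (Φ.iso x y h u) = inner ℂ u u := by
    have := LinearMap.adjoint_inner_right (Φ.iso x y h : E x →ₗ[ℂ] E y) u (Φ.iso x y h u)
    rw [hΦ x y h] at this
    simpa using this.symm
  have h₂ : ‖Φ.iso x y h u‖ ^ 2 = ‖u‖ ^ 2 := by
    rw [norm_sq_eq_re_inner (𝕜 := ℂ), norm_sq_eq_re_inner (𝕜 := ℂ), e]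
  exact (sq_eq_sq₀ (norm_nonneg _) (norm_nonneg _)).mp h₂

open Classical in
/-- The covariant difference `f x - Φ_{y,x} (f y)` if `y ∼ x`, and `0` otherwise. -/
noncomputable def diff (Φ : G.Connection E) (f : G.L2 E) (x y : X) : E x :=
  if h : 0 < G.b y x then val f x - Φ.iso y x h (val f y) else 0

theorem diff_add (Φ : G.Connection E) (f g : G.L2 E) (x y : X) :
    Φ.diff (f + g) x y = Φ.diff f x y + Φ.diff g x y := by
  unfold diff
  split_ifs
  · rw [val_add, val_add, map_add]; abel
  · simp

theorem diff_smul (Φ : G.Connection E) (c : ℂ) (f : G.L2 E) (x y : X) :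
    Φ.diff (c • f) x y = c • Φ.diff f x y := by
  unfold diff
  split_ifs
  · rw [val_smul, val_smul, map_smul, smul_sub]
  · simp

theorem summable_edge (G : WeightedGraph X) {w : X → ℝ} (hw : ∀ x, 0 ≤ w x)
    (hfin : w.support.Finite) : Summable fun p : X × X => G.b p.1 p.2 * w p.1 := by
  rw [summable_prod_of_nonneg fun p => mul_nonneg (G.b_nonneg _ _) (hw _)]
  refine ⟨fun x => (G.b_summable x).mul_right (w x), ?_⟩
  refine summable_of_hasFiniteSupport (hfin.subset fun x hx h0 => hx ?_)
  simp only [h0, mul_zero, tsum_zero]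

theorem norm_diff_sq_le [∀ x, FiniteDimensional ℂ (E x)] {Φ : G.Connection E}
    (hΦ : Φ.IsUnitary) (f : G.L2 E) (x y : X) :
    ‖Φ.diff f x y‖ ^ 2 ≤ 2 * (‖val f x‖ ^ 2 + ‖val f y‖ ^ 2) := by
  unfold diff
  split_ifs with h
  · have h₃ := norm_sub_le (val f x) (Φ.iso y x h (val f y))
    rw [hΦ.norm_iso] at h₃
    have h₄ := norm_nonneg (val f x - Φ.iso y x h (val f y))
    nlinarith [sq_nonneg (‖val f x‖ - ‖val f y‖)]
  · rw [norm_zero]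
    nlinarith [sq_nonneg ‖val f x‖, sq_nonneg ‖val f y‖]

theorem summable_diff_sq [∀ x, FiniteDimensional ℂ (E x)] {Φ : G.Connection E}
    (hΦ : Φ.IsUnitary) {f : G.L2 E} (hf : {x | val f x ≠ 0}.Finite) :
    Summable fun p : X × X => G.b p.1 p.2 * ‖Φ.diff f p.1 p.2‖ ^ 2 := by
  have h₁ : Summable fun p : X × X => G.b p.1 p.2 * ‖val f p.1‖ ^ 2 :=
    summable_edge G (w := fun x => ‖val f x‖ ^ 2) (fun x => sq_nonneg _)
      (hf.subset fun x hx h0 => hx (by simp [h0]))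
  have h₂ : Summable fun p : X × X => G.b p.1 p.2 * ‖val f p.2‖ ^ 2 := by
    have := (Equiv.prodComm X X).summable_iff.mpr h₁
    refine this.congr fun p => ?_
    simp [G.b_symm p.1 p.2]
  refine Summable.of_nonneg_of_le (fun p => mul_nonneg (G.b_nonneg _ _) (sq_nonneg _))
    (fun p => ?_) ((h₁.add h₂).mul_left 2)
  have := mul_le_mul_of_nonneg_left (norm_diff_sq_le hΦ f p.1 p.2) (G.b_nonneg p.1 p.2)
  linarith

theorem summable_diff_inner [∀ x, FiniteDimensional ℂ (E x)] {Φ : G.Connection E}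
    (hΦ : Φ.IsUnitary) {f g : G.L2 E} (hf : {x | val f x ≠ 0}.Finite)
    (hg : {x | val g x ≠ 0}.Finite) :
    Summable fun p : X × X =>
      (G.b p.1 p.2 : ℂ) * inner ℂ (Φ.diff f p.1 p.2) (Φ.diff g p.1 p.2) := by
  refine Summable.of_norm_bounded ((summable_diff_sq hΦ hf).add (summable_diff_sq hΦ hg))
    fun p => ?_
  rw [norm_mul, Complex.norm_real, Real.norm_of_nonneg (G.b_nonneg _ _), ← mul_add]
  refine mul_le_mul_of_nonneg_left ?_ (G.b_nonneg _ _)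
  have h := norm_inner_le_norm (𝕜 := ℂ) (Φ.diff f p.1 p.2) (Φ.diff g p.1 p.2)
  nlinarith [sq_nonneg (‖Φ.diff f p.1 p.2‖ - ‖Φ.diff g p.1 p.2‖),
    sq_nonneg (‖Φ.diff f p.1 p.2‖), sq_nonneg (‖Φ.diff g p.1 p.2‖)]

/-- The finitely supported sections. -/
def finSupp (G : WeightedGraph X) (E : X → Type*) [∀ x, NormedAddCommGroup (E x)]
    [∀ x, InnerProductSpace ℂ (E x)] : Submodule ℂ (G.L2 E) where
  carrier := {f | {x | val f x ≠ 0}.Finite}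
  zero_mem' := by
    simp [val_zero]
  add_mem' := by
    intro f g hf hg
    refine (Set.Finite.union hf hg).subset fun x hx => ?_
    by_contra h
    simp only [Set.mem_union, Set.mem_ofPred_eq, not_or, not_not] at h
    exact hx (by rw [val_add, h.1, h.2, add_zero])
  smul_mem' := by
    intro c f hf
    refine Set.Finite.subset hf fun x hx h0 => hx ?_
    rw [val_smul, h0, smul_zero]

/-- `1/2 ∑_{x ∼ y} b(x,y) (f x - Φ_{y,x} (f y), g x - Φ_{y,x} (g y))_x`. -/
noncomputable def covariantSum (Φ : G.Connection E) (f g : G.L2 E) : ℂ :=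
  1 / 2 * ∑' p : X × X,
    (G.b p.1 p.2 : ℂ) * inner ℂ (Φ.diff f p.1 p.2) (Φ.diff g p.1 p.2)

theorem covariantSum_symm (Φ : G.Connection E) (f g : G.L2 E) :
    conj (Φ.covariantSum f g) = Φ.covariantSum g f := by
  unfold covariantSum
  rw [map_mul, Complex.conj_tsum]
  congr 1
  · rw [show (1 / 2 : ℂ) = ((1 / 2 : ℝ) : ℂ) by norm_num, Complex.conj_ofReal]
  · refine tsum_congr fun p => ?_
    rw [map_mul, Complex.conj_ofReal, inner_conj_symm]

theorem covariantSum_add_right [∀ x, FiniteDimensional ℂ (E x)] {Φ : G.Connection E}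
    (hΦ : Φ.IsUnitary) (f g g' : finSupp G E) :
    Φ.covariantSum (f : G.L2 E) ((g : G.L2 E) + g') =
      Φ.covariantSum (f : G.L2 E) g + Φ.covariantSum (f : G.L2 E) g' := by
  unfold covariantSum
  rw [← mul_add,
    ← (summable_diff_inner hΦ f.2 g.2).tsum_add (summable_diff_inner hΦ f.2 g'.2)]
  congr 1
  refine tsum_congr fun p => ?_
  rw [diff_add, inner_add_right, mul_add]

theorem covariantSum_smul_right (Φ : G.Connection E) (c : ℂ) (f g : G.L2 E) :
    Φ.covariantSum f (c • g) = c * Φ.covariantSum f g := by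
  unfold covariantSum
  rw [mul_left_comm]
  congr 1
  rw [← tsum_mul_left]
  refine tsum_congr fun p => ?_
  rw [diff_smul, inner_smul_right, mul_left_comm]

theorem covariantSum_nonneg [∀ x, FiniteDimensional ℂ (E x)] {Φ : G.Connection E}
    (hΦ : Φ.IsUnitary) (f : finSupp G E) : 0 ≤ (Φ.covariantSum (f : G.L2 E) f).re := by
  unfold covariantSum
  rw [show (1 / 2 : ℂ) = ((1 / 2 : ℝ) : ℂ) by norm_num, Complex.re_ofReal_mul,
    Complex.re_tsum (summable_diff_inner hΦ f.2 f.2)]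
  refine mul_nonneg (by norm_num) (tsum_nonneg fun p => ?_)
  rw [Complex.re_ofReal_mul]
  exact mul_nonneg (G.b_nonneg _ _) (inner_self_nonneg (𝕜 := ℂ))

/-- The covariant form on the finitely supported sections. -/
noncomputable def covariantForm [∀ x, FiniteDimensional ℂ (E x)] (Φ : G.Connection E)
    (hΦ : Φ.IsUnitary) : NonnegForm (G.L2 E) where
  domain := finSupp G E
  form := LinearMap.mk₂'ₛₗ (starRingEnd ℂ) (RingHom.id ℂ)
    (fun f g => Φ.covariantSum (f : G.L2 E) g)
    (fun f f' g => by
      have h := congrArg (starRingEnd ℂ) (covariantSum_add_right hΦ g f f')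
      simp only [map_add, covariantSum_symm] at h
      exact h)
    (fun c f g => by
      have h := congrArg (starRingEnd ℂ) (Φ.covariantSum_smul_right c (g : G.L2 E) f)
      simp only [map_mul, covariantSum_symm] at h
      exact h)
    (fun f g g' => covariantSum_add_right hΦ f g g')
    (fun c f g => Φ.covariantSum_smul_right c _ _)
  symm f g := Φ.covariantSum_symm _ _
  nonneg f := covariantSum_nonneg hΦ f

/-- The form sum of the closure of the covariant form and of the form of `V`. -/
noncomputable def schrodingerForm [∀ x, FiniteDimensional ℂ (E x)] (Φ : G.Connection E)
    (hΦ : Φ.IsUnitary) (V : ∀ x, E x →L[ℂ] E x) (hV : ∀ x, (V x).IsPositive) :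
    NonnegForm (G.L2 E) :=
  (Φ.covariantForm hΦ).closure.add (G.potentialForm V hV)

/-- The covariant Schrödinger operator: the operator associated with the form sum. -/
noncomputable def schrodinger [∀ x, FiniteDimensional ℂ (E x)] (Φ : G.Connection E)
    (hΦ : Φ.IsUnitary) (V : ∀ x, E x →L[ℂ] E x) (hV : ∀ x, (V x).IsPositive) :
    G.L2 E →ₗ.[ℂ] G.L2 E :=
  (Φ.schrodingerForm hΦ V hV).operator

end Connection

end

end WeightedGraph

/-! The compactness comes from `W` alone. Square summability of `|W₁|` leaves only finitely many
vertices with `|W₁| > c/2`. Finiteness of the sum of `1 + ρ` over `{|W₂| > c/2}` makes that set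
finite as well, since every term exceeds 1. Hence `{|W| > c}` is finite for every `c > 0`, so `|W|`
is bounded and tends to zero at infinity. As the fibers are finite dimensional, multiplication by
such a `W` is a norm limit of finite-rank truncations. It is thus everywhere defined and compact
(`lp.isCompactOperator_of_diagonal`, `exists_compact_mulOp`), and it stays compact after composition
with the bounded resolvent.

The remaining work gives the resolvent a meaning. Both forms are squared norms of closable or closed
operators: a covariant derivative into square summable edge fields, and multiplication by `B` with
`V = B* B`. So the covariant form is closable and the form sum is closed; it is densely defined
because its domain contains the finitely supported sections. For such a form `q` and `a > 0`, the
domain with scalar product `q + a⟪·,·⟫` is a Hilbert space. If `J` is its inclusion into `H`, then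
`J J*` is the resolvent at `-a`, and self-adjointness follows from symmetry and surjectivity of the
operator plus one. -/

namespace NonnegForm

/-! ### Closed forms: squared norms of closed operators, closures and sums -/

variable {H K : Type*} [NormedAddCommGroup H] [InnerProductSpace ℂ H]
  [NormedAddCommGroup K] [InnerProductSpace ℂ K]

/-- The form `(u, v) ↦ ⟪T u, T v⟫` on the domain of an operator `T`. -/
noncomputable def ofLinearPMap (T : H →ₗ.[ℂ] K) : NonnegForm H where
  domain := T.domain
  form := LinearMap.mk₂'ₛₗ (starRingEnd ℂ) (RingHom.id ℂ) (fun u v => inner ℂ (T u) (T v))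
    (fun u u' v => by rw [T.map_add, inner_add_left])
    (fun c u v => by rw [T.map_smul, inner_smul_left]; rfl)
    (fun u v v' => by rw [T.map_add, inner_add_right])
    (fun c u v => by rw [T.map_smul, inner_smul_right]; rfl)
  symm u v := inner_conj_symm _ _
  nonneg u := inner_self_nonneg (𝕜 := ℂ)

/-- A form whose quadratic form is `‖T u‖ ^ 2` for a closed operator `T` is closed. -/
theorem isClosed_of_linearPMap [CompleteSpace K] {q : NonnegForm H} {T : H →ₗ.[ℂ] K}
    (hT : T.IsClosed) (hdom : q.domain = T.domain)
    (hq : ∀ u (h : u ∈ q.domain) (h' : u ∈ T.domain),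
      (q.form ⟨u, h⟩ ⟨u, h⟩).re = ‖T ⟨u, h'⟩‖ ^ 2) : q.IsClosed := by
  intro u x hux hu
  have hmem : ∀ n, (u n : H) ∈ T.domain := fun n => hdom ▸ (u n).2
  have hdiff : ∀ m n, (q.form (u m - u n) (u m - u n)).re =
      ‖T ⟨u m, hmem m⟩ - T ⟨u n, hmem n⟩‖ ^ 2 := by
    intro m n
    rw [← T.map_sub]
    exact hq _ (u m - u n).2 _
  -- Form-Cauchy means Cauchy for the images under `T`. Completeness of `K` gives a limit `y`, and
  -- the closed graph then forces `y = T x`.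
  have hcauchy : CauchySeq fun n => T ⟨u n, hmem n⟩ := by
    rw [Metric.cauchySeq_iff]
    intro ε hε
    obtain ⟨N, hN⟩ := hu (ε ^ 2) (by positivity)
    refine ⟨N, fun m hm n hn => ?_⟩
    have h := hN m hm n hn
    rw [hdiff] at h
    rw [dist_eq_norm]
    exact lt_of_pow_lt_pow_left₀ 2 hε.le h
  obtain ⟨y, hy⟩ := cauchySeq_tendsto_of_complete hcauchy
  have hxy : (x, y) ∈ T.graph :=
    hT.mem_of_tendsto (hux.prodMk_nhds hy) (Eventually.of_forall fun n => T.mem_graph ⟨u n, hmem n⟩)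
  obtain ⟨z, hzx, hzy⟩ := (LinearPMap.mem_graph_iff T).mp hxy
  have hxT : x ∈ T.domain := by
    have := z.2
    simp only at hzx
    rwa [hzx] at this
  have hTx : T ⟨x, hxT⟩ = y := by
    simp only at hzx hzy
    rw [← hzy]
    congr 1
    exact Subtype.ext hzx.symm
  have hx : x ∈ q.domain := hdom ▸ hxT
  refine ⟨hx, ?_⟩
  have h0 : Tendsto (fun n => ‖T ⟨u n, hmem n⟩ - y‖ ^ 2) atTop (𝓝 0) := by
    have := ((hy.sub_const y).norm).pow 2
    simpa using this
  refine h0.congr fun n => ?_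
  rw [← hTx, ← T.map_sub]
  exact (hq _ (u n - ⟨x, hx⟩).2 _).symm

theorem isClosed_ofLinearPMap [CompleteSpace K] {T : H →ₗ.[ℂ] K} (hT : T.IsClosed) :
    (ofLinearPMap T).IsClosed :=
  isClosed_of_linearPMap hT rfl fun _ _ _ => (norm_sq_eq_re_inner (𝕜 := ℂ) _).symm

/-- The graph of `T.closure` is the closure of the graph of `T`. A sequence in the latter tending to
`(x, T.closure x)` gives convergence in `H` and in the form seminorm at once. -/
theorem isClosure_ofLinearPMap_closure [CompleteSpace K] {T : H →ₗ.[ℂ] K} (hT : T.IsClosable) :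
    (ofLinearPMap T.closure).IsClosure (ofLinearPMap T) := by
  have hle := T.le_closure
  have hval : ∀ u : T.domain, T.closure (Submodule.inclusion hle.1 u) = T u := fun u =>
    (hle.2 (x := u) (y := Submodule.inclusion hle.1 u) rfl).symm
  refine ⟨isClosed_ofLinearPMap hT.closure_isClosed, hle.1, fun u v => ?_,
    fun (x : T.closure.domain) => ?_⟩
  · exact congrArg₂ (inner ℂ) (hval u) (hval v)
  · have hx : ((x : H), T.closure x) ∈ _root_.closure (T.graph : Set (H × K)) := by
      have h := T.closure.mem_graph x
      rwa [← hT.graph_closure_eq_closure_graph] at h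
    obtain ⟨w, hw, hwx⟩ := mem_closure_iff_seq_limit.mp hx
    choose u hu₁ hu₂ using fun n => (LinearPMap.mem_graph_iff T).mp (hw n)
    refine ⟨u, ?_, ?_⟩
    · simp only [hu₁]
      exact (continuous_fst.tendsto _).comp hwx
    · have h2 : Tendsto (fun n => T (u n)) atTop (𝓝 (T.closure x)) := by
        simp only [hu₂]
        exact (continuous_snd.tendsto _).comp hwx
      have h0 : Tendsto (fun n => ‖T (u n) - T.closure x‖ ^ 2) atTop (𝓝 0) := by
        have := ((h2.sub_const (T.closure x)).norm).pow 2
        simpa using this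
      refine h0.congr fun n => ?_
      have e : T.closure (Submodule.inclusion hle.1 (u n) - x) = T (u n) - T.closure x :=
        (T.closure.map_sub _ _).trans (congrArg (· - T.closure x) (hval (u n)))
      rw [← e]
      exact norm_sq_eq_re_inner (𝕜 := ℂ) _

/-- `closure` is a choice with a default value; exhibiting one closure rules the default out. -/
theorem closure_isClosure {q q' : NonnegForm H} (h : q'.IsClosure q) : q.closure.IsClosure q := by
  have hex : ∃ q' : NonnegForm H, q'.IsClosure q := ⟨q', h⟩
  rw [closure, dif_pos hex]
  exact hex.choose_spec

theorem add_form_apply (q₁ q₂ : NonnegForm H) (u v : (q₁.add q₂).domain) :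
    (q₁.add q₂).form u v = q₁.form ⟨u, u.2.1⟩ ⟨v, v.2.1⟩ + q₂.form ⟨u, u.2.2⟩ ⟨v, v.2.2⟩ := rfl

/-- The sum of two closed forms is closed. -/
theorem IsClosed.add {q₁ q₂ : NonnegForm H} (h₁ : q₁.IsClosed) (h₂ : q₂.IsClosed) :
    (q₁.add q₂).IsClosed := by
  intro u x hux hu
  -- Each summand is nonnegative, hence dominated by the sum, so Cauchy sequences for the sum are
  -- Cauchy for both forms.
  have hu₁ : q₁.FormCauchy fun n => ⟨u n, (u n).2.1⟩ := by
    intro ε hε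
    obtain ⟨N, hN⟩ := hu ε hε
    refine ⟨N, fun m hm n hn => lt_of_le_of_lt ?_ (hN m hm n hn)⟩
    rw [add_form_apply, Complex.add_re]
    exact le_add_of_nonneg_right (q₂.nonneg _)
  have hu₂ : q₂.FormCauchy fun n => ⟨u n, (u n).2.2⟩ := by
    intro ε hε
    obtain ⟨N, hN⟩ := hu ε hε
    refine ⟨N, fun m hm n hn => lt_of_le_of_lt ?_ (hN m hm n hn)⟩
    rw [add_form_apply, Complex.add_re]
    exact le_add_of_nonneg_left (q₁.nonneg _)
  obtain ⟨hx₁, ht₁⟩ := h₁ _ x hux hu₁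
  obtain ⟨hx₂, ht₂⟩ := h₂ _ x hux hu₂
  refine ⟨⟨hx₁, hx₂⟩, ?_⟩
  have := ht₁.add ht₂
  rw [add_zero] at this
  exact this

/-! ### The form domain as a Hilbert space -/

/-- The domain of `q`, with the scalar product `q(u, v) + a ⟪u, v⟫`. -/
def FormSpace (q : NonnegForm H) {a : ℝ} (_ha : 0 < a) : Type _ := q.domain

section FormSpace

variable (q : NonnegForm H) {a : ℝ} (ha : 0 < a)

instance : AddCommGroup (q.FormSpace ha) := inferInstanceAs (AddCommGroup q.domain)

instance : Module ℂ (q.FormSpace ha) := inferInstanceAs (Module ℂ q.domain)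

/-- The scalar product `q(u, v) + a ⟪u, v⟫`. -/
noncomputable abbrev formCore : InnerProductSpace.Core ℂ (q.FormSpace ha) where
  inner u v := q.form u v + (a : ℂ) * inner ℂ (u : q.domain).1 (v : q.domain).1
  conj_inner_symm u v := by
    rw [map_add, map_mul, Complex.conj_ofReal, inner_conj_symm]
    exact congrArg (· + _) (q.symm v u)
  re_inner_nonneg u := by
    have h₁ := q.nonneg u
    have h₂ : 0 ≤ (inner ℂ (u : q.domain).1 (u : q.domain).1).re := inner_self_nonneg (𝕜 := ℂ)
    change 0 ≤ (q.form u u + (a : ℂ) * inner ℂ (u : q.domain).1 (u : q.domain).1).re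
    rw [Complex.add_re, Complex.re_ofReal_mul]
    positivity
  add_left u v w := by
    have h₁ : q.form (u + v) w = q.form u w + q.form v w :=
      LinearMap.congr_fun (q.form.map_add u v) w
    have h₂ : inner ℂ ((u + v : q.FormSpace ha) : q.domain).1 (w : q.domain).1 =
        inner ℂ (u : q.domain).1 (w : q.domain).1 + inner ℂ (v : q.domain).1 (w : q.domain).1 :=
      inner_add_left _ _ _
    rw [h₁, h₂]
    ring
  smul_left u v c := by
    have h₁ : q.form (c • u) v = conj c * q.form u v :=
      LinearMap.congr_fun (q.form.map_smulₛₗ c u) v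
    have h₂ : inner ℂ ((c • u : q.FormSpace ha) : q.domain).1 (v : q.domain).1 =
        conj c * inner ℂ (u : q.domain).1 (v : q.domain).1 := inner_smul_left _ _ _
    rw [h₁, h₂]
    ring
  definite u hu := by
    have h := congrArg Complex.re hu
    change (q.form u u + (a : ℂ) * inner ℂ (u : q.domain).1 (u : q.domain).1).re = 0 at h
    rw [Complex.add_re, Complex.re_ofReal_mul] at h
    have h₁ := q.nonneg u
    have h₂ : (inner ℂ (u : q.domain).1 (u : q.domain).1).re = ‖(u : q.domain).1‖ ^ 2 :=
      (norm_sq_eq_re_inner (𝕜 := ℂ) _).symm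
    rw [h₂] at h
    have h₃ : ‖(u : q.domain).1‖ ^ 2 = 0 := by
      by_contra hne
      have : 0 < ‖(u : q.domain).1‖ ^ 2 := lt_of_le_of_ne (by positivity) (Ne.symm hne)
      have := mul_pos ha this
      linarith
    exact Subtype.ext (norm_eq_zero.mp (pow_eq_zero_iff two_ne_zero |>.mp h₃))

noncomputable instance : NormedAddCommGroup (q.FormSpace ha) :=
  (q.formCore ha).toNormedAddCommGroup

noncomputable instance : InnerProductSpace ℂ (q.FormSpace ha) :=
  InnerProductSpace.ofCore (q.formCore ha).toCore

theorem formSpace_inner (u v : q.FormSpace ha) :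
    inner ℂ u v = q.form u v + (a : ℂ) * inner ℂ (u : q.domain).1 (v : q.domain).1 := rfl

theorem formSpace_norm_sq (u : q.FormSpace ha) :
    ‖u‖ ^ 2 = (q.form u u).re + a * ‖(u : q.domain).1‖ ^ 2 := by
  have h₂ : (inner ℂ (u : q.domain).1 (u : q.domain).1).re = ‖(u : q.domain).1‖ ^ 2 :=
    (norm_sq_eq_re_inner (𝕜 := ℂ) _).symm
  rw [norm_sq_eq_re_inner (𝕜 := ℂ), formSpace_inner]
  change (q.form u u + (a : ℂ) * inner ℂ (u : q.domain).1 (u : q.domain).1).re = _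
  rw [Complex.add_re, Complex.re_ofReal_mul, h₂]

/-- The inclusion of the form domain. -/
noncomputable def formIncl : q.FormSpace ha →L[ℂ] H :=
  -- The constant comes from `a ‖u‖² ≤ q(u, u) + a ‖u‖²`.
  LinearMap.mkContinuous (q.domain.subtype : q.FormSpace ha →ₗ[ℂ] H) (√a)⁻¹ fun u => by
    have h := formSpace_norm_sq q ha u
    have h₁ := q.nonneg u
    have hs : 0 < √a := Real.sqrt_pos.mpr ha
    change ‖(u : q.domain).1‖ ≤ _
    rw [inv_mul_eq_div, le_div_iff₀ hs]
    refine le_of_sq_le_sq ?_ (norm_nonneg _)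
    rw [mul_pow, Real.sq_sqrt ha.le, h]
    linarith

theorem formIncl_apply (u : q.FormSpace ha) : q.formIncl ha u = (u : q.domain).1 := rfl

/-- The form norm controls both the norm of `H` and the form seminorm, so a Cauchy sequence
satisfies the hypotheses of closedness. Completeness is what makes the adjoint of `formIncl`
available. -/
theorem IsClosed.completeSpace [CompleteSpace H] {q : NonnegForm H} (hq : q.IsClosed) :
    CompleteSpace (q.FormSpace ha) := by
  refine Metric.complete_of_cauchySeq_tendsto fun u hu => ?_
  obtain ⟨x, hx⟩ := cauchySeq_tendsto_of_complete
    ((q.formIncl ha).uniformContinuous.comp_cauchySeq hu)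
  have hc : q.FormCauchy u := by
    intro ε hε
    obtain ⟨N, hN⟩ := Metric.cauchySeq_iff.mp hu (√ε) (Real.sqrt_pos.mpr hε)
    refine ⟨N, fun m hm n hn => ?_⟩
    have h := hN m hm n hn
    rw [dist_eq_norm] at h
    have h' : ‖u m - u n‖ ^ 2 < ε := by
      have := pow_lt_pow_left₀ h (norm_nonneg _) two_ne_zero
      rwa [Real.sq_sqrt hε.le] at this
    rw [formSpace_norm_sq] at h'
    refine lt_of_le_of_lt ?_ h'
    exact le_add_of_nonneg_right (by positivity)
  obtain ⟨hxd, ht⟩ := hq u x hx hc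
  refine ⟨(⟨x, hxd⟩ : q.domain), tendsto_iff_norm_sub_tendsto_zero.mpr ?_⟩
  have h2 : Tendsto (fun n => ‖((u n : q.domain).1 : H) - x‖ ^ 2) atTop (𝓝 0) := by
    have := ((hx.sub_const x).norm).pow 2
    simpa [formIncl_apply] using this
  have h3 := ht.add (h2.const_mul a)
  rw [mul_zero, add_zero] at h3
  have h4 : Tendsto (fun n => ‖u n - (show q.FormSpace ha from (⟨x, hxd⟩ : q.domain))‖ ^ 2) atTop
      (𝓝 0) := h3.congr fun n => (formSpace_norm_sq q ha _).symm
  have h5 := (Real.continuous_sqrt.tendsto 0).comp h4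
  rw [Real.sqrt_zero] at h5
  exact h5.congr fun n => Real.sqrt_sq (norm_nonneg _)

end FormSpace

/-! ### The operator associated with a closed form -/

/-- Density makes `w` unique for given `u`: if `(0, w)` is in the relation, then `w` is orthogonal
to the form domain. Single-valuedness is needed for `toLinearPMap` to return an operator with the
given graph. -/
theorem operator_graph {q : NonnegForm H} (hd : Dense (q.domain : Set H)) :
    q.operator.graph = q.operatorGraph := by
  refine Submodule.toLinearPMap_graph_eq _ ?_
  rintro ⟨u, w⟩ ⟨h, hw⟩ h0
  simp only at h0 hw h
  subst h0
  refine hd.eq_zero_of_inner_right ℂ fun v hv => ?_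
  rw [← hw ⟨v, hv⟩]
  exact (q.form _).map_zero

theorem mem_operator_iff {q : NonnegForm H} (hd : Dense (q.domain : Set H)) (u w : H) :
    (∃ h : u ∈ q.operator.domain, q.operator ⟨u, h⟩ = w) ↔
      ∃ h : u ∈ q.domain, ∀ v : q.domain, q.form v ⟨u, h⟩ = inner ℂ (v : H) w := by
  have h : (u, w) ∈ q.operator.graph ↔ (u, w) ∈ q.operatorGraph := by rw [operator_graph hd]
  refine Iff.trans ?_ h
  rw [LinearPMap.mem_graph_iff]
  constructor
  · rintro ⟨hu, hw⟩
    exact ⟨⟨u, hu⟩, rfl, hw⟩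
  · rintro ⟨⟨z, hz⟩, hzu, hw⟩
    simp only at hzu
    subst hzu
    exact ⟨hz, hw⟩

theorem operator_spec {q : NonnegForm H} (hd : Dense (q.domain : Set H)) (u : q.operator.domain) :
    ∃ h : (u : H) ∈ q.domain, ∀ v : q.domain, q.form v ⟨u, h⟩ = inner ℂ (v : H) (q.operator u) :=
  (mem_operator_iff hd _ _).mp ⟨u.2, rfl⟩

/-- The resolvent of the operator associated with a closed, densely defined nonnegative form. -/
theorem exists_isBoundedInverseOfAdd [CompleteSpace H] {q : NonnegForm H} (hq : q.IsClosed)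
    (hd : Dense (q.domain : Set H)) {a : ℝ} (ha : 0 < a) :
    ∃ R : H →L[ℂ] H, IsBoundedInverseOfAdd q.operator a R := by
  have := hq.completeSpace ha
  set J := q.formIncl ha
  have hJ : ∀ (f : H) (v : q.FormSpace ha),
      inner ℂ v (J.adjoint f) = inner ℂ (v : q.domain).1 f := fun f v =>
    ContinuousLinearMap.adjoint_inner_right J v f
  -- By `hJ`, the vector `u = J* f` satisfies `q(v, u) + a⟪v, u⟫ = ⟪v, f⟫` for all `v`. This is the
  -- weak form of `(T + a) u = f`.
  refine ⟨J ∘L J.adjoint, fun f => ?_, fun u => ?_⟩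
  · have h : ∃ h : J (J.adjoint f) ∈ q.operator.domain,
        q.operator ⟨_, h⟩ = f - (a : ℂ) • J (J.adjoint f) := by
      refine (mem_operator_iff hd _ _).mpr ⟨(J.adjoint f : q.domain).2, fun v => ?_⟩
      rw [inner_sub_right, inner_smul_right]
      exact eq_sub_of_add_eq (hJ f v)
    obtain ⟨h, e⟩ := h
    refine ⟨h, ?_⟩
    change q.operator ⟨J (J.adjoint f), h⟩ + (a : ℂ) • J (J.adjoint f) = f
    rw [e, sub_add_cancel]
  · obtain ⟨h, hu⟩ := operator_spec hd u
    have e : J.adjoint (q.operator u + (a : ℂ) • (u : H)) =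
        (show q.FormSpace ha from (⟨u, h⟩ : q.domain)) := by
      refine ext_inner_left ℂ fun v => ?_
      rw [hJ, inner_add_right, inner_smul_right]
      exact congrArg (· + _) (hu v).symm
    rw [ContinuousLinearMap.comp_apply, e]
    rfl

/-- The operator associated with a closed, densely defined nonnegative form is self-adjoint. -/
theorem isSelfAdjoint_operator [CompleteSpace H] {q : NonnegForm H} (hq : q.IsClosed)
    (hd : Dense (q.domain : Set H)) : IsSelfAdjoint q.operator := by
  obtain ⟨R, hR, -⟩ := exists_isBoundedInverseOfAdd hq hd one_pos
  simp only [Complex.ofReal_one, one_smul] at hR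
  have hsymm : q.operator.IsFormalAdjoint q.operator := by
    intro u v
    obtain ⟨hu, hu'⟩ := operator_spec hd u
    obtain ⟨hv, hv'⟩ := operator_spec hd v
    rw [← hv' ⟨u, hu⟩, ← inner_conj_symm, ← hu' ⟨v, hv⟩, q.symm]
  -- Let `f` be orthogonal to the operator domain. Testing against `R f` gives `q(R f, R f) + ‖R f‖²
  -- = ⟪R f, f⟫ = 0`, so `R f = 0` and `f = (T + 1) R f = 0`.
  have hdense : Dense (q.operator.domain : Set H) := by
    rw [Submodule.dense_iff_topologicalClosure_eq_top,
      Submodule.topologicalClosure_eq_top_iff, Submodule.eq_bot_iff]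
    intro f hf
    obtain ⟨h, hRf⟩ := hR f
    rw [Submodule.mem_orthogonal] at hf
    obtain ⟨hu, hu'⟩ := operator_spec hd ⟨R f, h⟩
    have h₁ := hf (R f) h
    have h₂ := hu' ⟨R f, hu⟩
    have h₁ : q.form ⟨R f, hu⟩ ⟨R f, hu⟩ + inner ℂ (R f) (R f) = 0 := by
      rw [h₂, ← inner_add_right, hRf]
      exact h₁
    have h₃ := congrArg Complex.re h₁
    rw [Complex.add_re] at h₃
    have h₄ : (inner ℂ (R f) (R f)).re = ‖R f‖ ^ 2 := (norm_sq_eq_re_inner (𝕜 := ℂ) _).symm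
    rw [h₄] at h₃
    have h₅ := q.nonneg ⟨R f, hu⟩
    have h₆ : R f = 0 := by
      have : ‖R f‖ ^ 2 = 0 := le_antisymm (by simp only [Complex.zero_re] at h₃; linarith)
        (by positivity)
      simpa using this
    have h₇ : (⟨R f, h⟩ : q.operator.domain) = 0 := Subtype.ext h₆
    rw [← hRf, h₇, h₆, LinearPMap.map_zero, add_zero]
  rw [LinearPMap.isSelfAdjoint_def]
  have hle := hsymm.le_adjoint hdense
  refine le_antisymm ?_ hle
  have hadj := LinearPMap.adjoint_isFormalAdjoint hdense
  -- For `y` in the domain of `T*`, put `u = R (T* y + y)`. Then `y - u` is orthogonal to the range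
  -- of `T + 1`, which is all of `H`; so `y = u` lies in the domain of `T`.
  have hdom : q.operator.adjoint.domain ≤ q.operator.domain := by
    intro y hy
    obtain ⟨h, hu⟩ := hR (q.operator.adjoint ⟨y, hy⟩ + y)
    set u := R (q.operator.adjoint ⟨y, hy⟩ + y)
    have key : y - u = 0 := by
      refine ext_inner_right ℂ fun g => ?_
      obtain ⟨hg, hg'⟩ := hR g
      have h₁ := hadj ⟨y, hy⟩ ⟨R g, hg⟩
      have h₂ := hsymm ⟨u, h⟩ ⟨R g, hg⟩
      simp only at h₁ h₂
      have h₃ : q.operator ⟨u, h⟩ = q.operator.adjoint ⟨y, hy⟩ + y - u := eq_sub_of_add_eq hu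
      rw [h₃, inner_sub_left, inner_add_left, h₁] at h₂
      rw [← hg', inner_zero_left, inner_add_right, inner_sub_left, inner_sub_left, ← h₂]
      ring
    rw [sub_eq_zero.mp key]
    exact h
  exact ⟨hdom, fun x y hxy => (hle.2 hxy.symm).symm⟩

end NonnegForm

/-! ### Compact diagonal operators on `ℓ²`-sums -/

namespace lp

variable {ι : Type*} {F : ι → Type*} [∀ i, NormedAddCommGroup (F i)]
  [∀ i, InnerProductSpace ℂ (F i)]

theorem continuous_apply_two (i : ι) : Continuous fun f : lp F 2 => f i :=
  (lp.evalCLM ℂ F 2 i).continuous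

/-- A bounded operator on an `ℓ²`-sum which acts diagonally, with blocks tending to zero and finite
dimensional summands, is compact. -/
theorem isCompactOperator_of_diagonal [∀ i, FiniteDimensional ℂ (F i)] [∀ i, CompleteSpace (F i)]
    (A : ∀ i, F i →L[ℂ] F i) (T : lp F 2 →L[ℂ] lp F 2) (hT : ∀ f i, T f i = A i (f i))
    (hA : ∀ c : ℝ, 0 < c → {i | c < ‖A i‖}.Finite) : IsCompactOperator T := by
  classical
  -- Truncation to the blocks in `s`; every summand factors through the finite dimensional space `F
  -- i`.
  let P : Finset ι → lp F 2 →L[ℂ] lp F 2 := fun s =>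
    ∑ i ∈ s, lp.singleContinuousLinearMap ℂ F 2 i ∘L A i ∘L lp.evalCLM ℂ F 2 i
  have hP : ∀ s f i, P s f i = if i ∈ s then A i (f i) else 0 := by
    intro s f i
    simp only [P, sum_apply, lp.coeFn_sum, Finset.sum_apply,
      ContinuousLinearMap.comp_apply, lp.singleContinuousLinearMap_apply]
    split_ifs with h
    · rw [Finset.sum_eq_single_of_mem i h]
      · rw [lp.single_apply_self]; rfl
      · intro j _ hj
        rw [lp.single_apply_ne _ _ _ hj.symm]
    · refine Finset.sum_eq_zero fun j hj => ?_
      rw [lp.single_apply_ne]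
      rintro rfl
      exact h hj
  have hcomp : ∀ s, IsCompactOperator (P s) := by
    intro s
    refine (compactOperator (RingHom.id ℂ) (lp F 2) (lp F 2)).sum_mem fun i _ => ?_
    have : ProperSpace (F i) := FiniteDimensional.proper ℂ (F i)
    exact (isCompactOperator_of_locallyCompactSpace_dom
      (A i ∘L lp.evalCLM ℂ F 2 i)).clm_comp (lp.singleContinuousLinearMap ℂ F 2 i)
  refine isCompactOperator_of_tendsto (l := atTop) (F := P) ?_ (Eventually.of_forall hcomp)
  rw [tendsto_iff_norm_sub_tendsto_zero, Metric.tendsto_atTop]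
  intro ε hε
  -- Once `s` contains all blocks of norm above `ε / 2`, the error is diagonal with blocks of norm
  -- at most `ε / 2`. The halving makes the final inequality strict.
  refine ⟨(hA (ε / 2) (by positivity)).toFinset, fun s hs => ?_⟩
  rw [Real.dist_eq, sub_zero, abs_of_nonneg (norm_nonneg _)]
  refine lt_of_le_of_lt ?_ (half_lt_self hε)
  refine ContinuousLinearMap.opNorm_le_bound _ (by positivity) fun f => ?_
  have hblock : ∀ i (u : F i), ‖(if i ∈ s then A i u else 0) - A i u‖ ≤ ε / 2 * ‖u‖ := by
    intro i u
    split_ifs with h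
    · rw [sub_self, _root_.norm_zero]; positivity
    · rw [zero_sub, _root_.norm_neg]
      refine (A i).le_of_opNorm_le ?_ _
      by_contra hc
      exact h (hs (by simpa using hc))
  have hb : ∀ i, ‖(P s - T) f i‖ ≤ ε / 2 * ‖f i‖ := fun i =>
    (congrArg norm (congrArg₂ (· - ·) (hP s f i) (hT f i))).trans_le (hblock i (f i))
  -- Comparison with a scalar multiple of `f` lets `lp.norm_mono` turn the fiberwise bounds into a
  -- bound on the norm.
  have hn : ‖(P s - T) f‖ ≤ ‖((ε / 2 : ℝ) : ℂ) • f‖ := by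
    refine lp.norm_mono two_ne_zero fun i => ?_
    rw [lp.coeFn_smul, Pi.smul_apply, norm_smul, Complex.norm_real,
      Real.norm_of_nonneg (by positivity)]
    exact hb i
  rwa [norm_smul, Complex.norm_real, Real.norm_of_nonneg (by positivity)] at hn

end lp

/-! ### Multiplication operators, the potential form and finitely supported sections -/

namespace WeightedGraph

variable {X : Type*} {G : WeightedGraph X} {E : X → Type*} [∀ x, NormedAddCommGroup (E x)]
  [∀ x, InnerProductSpace ℂ (E x)]

instance (x : X) [h : FiniteDimensional ℂ (E x)] : FiniteDimensional ℂ (G.WFiber E x) := h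

theorem norm_toW (x : X) (u : E x) : ‖G.toW E x u‖ = √(G.ρ x) * ‖u‖ := by
  rw [← Real.sqrt_sq (norm_nonneg (G.toW E x u)), norm_toW_sq, Real.sqrt_mul (G.ρ_pos x).le,
    Real.sqrt_sq (norm_nonneg u)]

theorem norm_eq_val (f : G.L2 E) (x : X) : ‖f x‖ = √(G.ρ x) * ‖val f x‖ :=
  norm_toW x (val f x)

theorem norm_sq_eq_tsum (f : G.L2 E) : ‖f‖ ^ 2 = ∑' x, G.ρ x * ‖val f x‖ ^ 2 := by
  have h := lp.norm_rpow_eq_tsum (p := 2) (by norm_num) f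
  rw [show (2 : ENNReal).toReal = ((2 : ℕ) : ℝ) by norm_num, Real.rpow_natCast] at h
  rw [h]
  refine tsum_congr fun x => ?_
  rw [Real.rpow_natCast]
  exact norm_toW_sq x (val f x)

/-- The values of an `L²`-section depend continuously on it. -/
theorem continuous_val (x : X) [FiniteDimensional ℂ (E x)] :
    Continuous fun f : G.L2 E => val f x :=
  ((G.toW E x).symm : G.WFiber E x →ₗ[ℂ] E x).continuous_of_finiteDimensional.comp
    (lp.continuous_apply_two x)

/-- An endomorphism of `E x`, acting on the fiber with the weighted scalar product. -/
noncomputable def fiberMap (G : WeightedGraph X) (x : X) (A : E x →L[ℂ] E x) :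
    G.WFiber E x →L[ℂ] G.WFiber E x :=
  LinearMap.mkContinuous ((G.toW E x).conj (A : E x →ₗ[ℂ] E x)) ‖A‖ fun u => by
    obtain ⟨v, rfl⟩ := (G.toW E x).surjective u
    rw [LinearEquiv.conj_apply_apply, LinearEquiv.symm_apply_apply, norm_toW, norm_toW,
      mul_left_comm]
    exact mul_le_mul_of_nonneg_left (A.le_opNorm v) (Real.sqrt_nonneg _)

theorem norm_fiberMap_le (x : X) (A : E x →L[ℂ] E x) : ‖G.fiberMap x A‖ ≤ ‖A‖ :=
  LinearMap.mkContinuous_norm_le _ (norm_nonneg _) _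

theorem norm_mulOp_apply_le {W : ∀ x, E x →L[ℂ] E x} {C : ℝ} (hC : ∀ x, ‖W x‖ ≤ C)
    (f : G.L2 E) (x : X) : ‖G.toW E x (W x (val f x))‖ ≤ ‖((C : ℂ) • f) x‖ := by
  have hC0 : 0 ≤ C := (norm_nonneg _).trans (hC x)
  rw [lp.coeFn_smul, Pi.smul_apply, norm_smul, Complex.norm_real, Real.norm_of_nonneg hC0,
    norm_toW, norm_eq_val, mul_left_comm]
  exact mul_le_mul_of_nonneg_left ((W x).le_of_opNorm_le (hC x) _) (Real.sqrt_nonneg _)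

theorem mulOp_domain_eq_top {W : ∀ x, E x →L[ℂ] E x} {C : ℝ} (hC : ∀ x, ‖W x‖ ≤ C) :
    (G.mulOp W).domain = ⊤ :=
  Submodule.eq_top_iff'.mpr fun f => by
    refine (memL2_iff fun x => W x (val f x)).mpr ?_
    have h := (memL2_iff (G := G) (val f)).mp (lp.memℓp f)
    refine Summable.of_nonneg_of_le (fun x => mul_nonneg (G.ρ_pos x).le (sq_nonneg _))
      (fun x => ?_) (h.mul_left (C ^ 2))
    rw [mul_left_comm, ← mul_pow]
    exact mul_le_mul_of_nonneg_left
      (pow_le_pow_left₀ (norm_nonneg _) ((W x).le_of_opNorm_le (hC x) _) 2) (G.ρ_pos x).le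

/-- Because the domain is maximal, the graph is cut out by the equations `g x = W x (f x)`, one for
each vertex. Each is a closed condition, since evaluation at a vertex is continuous. -/
theorem mulOp_isClosed [∀ x, FiniteDimensional ℂ (E x)] (W : ∀ x, E x →L[ℂ] E x) :
    (G.mulOp W).IsClosed := by
  have e : ((G.mulOp W).graph : Set (G.L2 E × G.L2 E)) =
      ⋂ x, {p | p.2 x = G.toW E x (W x (val p.1 x))} := by
    ext ⟨f, g⟩
    simp only [SetLike.mem_coe, LinearPMap.mem_graph_iff, Set.mem_iInter, Set.mem_ofPred_eq]
    constructor
    · rintro ⟨u, rfl, rfl⟩ x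
      rfl
    · intro h
      have hg : (fun x => G.toW E x (W x (val f x))) = g := funext fun x => (h x).symm
      have hf : f ∈ (G.mulOp W).domain := by
        change Memℓp (fun x => G.toW E x (W x (val f x))) 2
        rw [hg]
        exact lp.memℓp g
      exact ⟨⟨f, hf⟩, rfl, lp.ext hg⟩
  rw [LinearPMap.IsClosed, e]
  refine isClosed_iInter fun x => isClosed_eq ((lp.continuous_apply_two x).comp continuous_snd) ?_
  exact ((G.toW E x : E x →ₗ[ℂ] G.WFiber E x).continuous_of_finiteDimensional).comp
    ((W x).continuous.comp ((continuous_val x).comp continuous_fst))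

/-- The form of a nonnegative potential is closed. -/
theorem potentialForm_isClosed [∀ x, FiniteDimensional ℂ (E x)] (V : ∀ x, E x →L[ℂ] E x)
    (hV : ∀ x, (V x).IsPositive) : (G.potentialForm V hV).IsClosed := by
  have hc : ∀ x, CompleteSpace (E x) := fun x => FiniteDimensional.complete ℂ (E x)
  -- With `V = B* B` the potential form becomes `‖B f‖²`, and its domain is exactly the maximal
  -- domain of multiplication by `B`.
  have hB : ∀ x, ∃ B : E x →L[ℂ] E x, V x = star B * B := fun x =>
    CStarAlgebra.nonneg_iff_eq_star_mul_self.mp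
      ((ContinuousLinearMap.nonneg_iff_isPositive (V x)).mpr (hV x))
  choose B hB using hB
  have hnorm : ∀ x (u : E x), (inner ℂ u (V x u)).re = ‖B x u‖ ^ 2 := by
    intro x u
    rw [hB x, mul_apply_eq_comp, ContinuousLinearMap.star_eq_adjoint,
      ContinuousLinearMap.adjoint_inner_right]
    exact (norm_sq_eq_re_inner (𝕜 := ℂ) _).symm
  refine NonnegForm.isClosed_of_linearPMap (mulOp_isClosed (G := G) B) ?_ ?_
  · ext f
    refine Iff.trans ?_ (memL2_iff (G := G) fun x => B x (val f x)).symm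
    change Summable _ ↔ _
    simp only [hnorm]
  · intro f hf hf'
    have hs : Summable fun x => (G.ρ x : ℂ) * inner ℂ (val f x) (V x (val f x)) :=
      potential_summable hV hf hf
    change (∑' x, (G.ρ x : ℂ) * inner ℂ (val f x) (V x (val f x))).re = _
    rw [Complex.re_tsum hs, norm_sq_eq_tsum]
    refine tsum_congr fun x => ?_
    rw [Complex.re_ofReal_mul, hnorm]
    rfl

/-- The finitely supported sections are dense. -/
theorem dense_finSupp : Dense (Connection.finSupp G E : Set (G.L2 E)) := by
  classical
  intro f
  refine mem_closure_of_tendsto (lp.hasSum_single ENNReal.ofNat_ne_top f)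
    (Eventually.of_forall fun s => (Connection.finSupp G E).sum_mem fun x _ => ?_)
  refine (Set.finite_singleton x).subset fun y hy => ?_
  by_contra h
  exact hy (lp.single_apply_ne 2 x (f x) h)

theorem finSupp_le_potentialDomain (V : ∀ x, E x →L[ℂ] E x) (hV : ∀ x, (V x).IsPositive) :
    Connection.finSupp G E ≤ G.potentialDomain V hV := fun f hf =>
  summable_of_hasFiniteSupport (Set.Finite.subset hf fun x hx h0 => hx (by simp [h0]))

/-! ### The covariant derivative and closability of the covariant form -/

namespace Connection

theorem continuous_diff [∀ x, FiniteDimensional ℂ (E x)] (Φ : G.Connection E) (x y : X) :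
    Continuous fun f : G.L2 E => Φ.diff f x y := by
  unfold diff
  split_ifs with h
  · exact (continuous_val x).sub
      ((Φ.iso y x h : E y →ₗ[ℂ] E x).continuous_of_finiteDimensional.comp (continuous_val y))
  · exact continuous_const

/-- The space of square summable edge fields. -/
abbrev EdgeL2 (E : X → Type*) [∀ x, NormedAddCommGroup (E x)] [∀ x, InnerProductSpace ℂ (E x)] :
    Type _ := lp (fun p : X × X => E p.1) 2

/-- The covariant derivative `f ↦ √(b / 2) (f x - Φ_{y,x} (f y))` of a section. -/
noncomputable def edgeField (Φ : G.Connection E) (f : G.L2 E) (p : X × X) : E p.1 :=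
  ((√(G.b p.1 p.2 / 2) : ℝ) : ℂ) • Φ.diff f p.1 p.2

theorem norm_edgeField_sq (Φ : G.Connection E) (f : G.L2 E) (p : X × X) :
    ‖Φ.edgeField f p‖ ^ 2 = 2⁻¹ * (G.b p.1 p.2 * ‖Φ.diff f p.1 p.2‖ ^ 2) := by
  have := G.b_nonneg p.1 p.2
  rw [edgeField, norm_smul, mul_pow, Complex.norm_real, Real.norm_of_nonneg (Real.sqrt_nonneg _),
    Real.sq_sqrt (by positivity)]
  ring

theorem memℓp_edgeField [∀ x, FiniteDimensional ℂ (E x)] {Φ : G.Connection E} (hΦ : Φ.IsUnitary)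
    {f : G.L2 E} (hf : {x | val f x ≠ 0}.Finite) : Memℓp (Φ.edgeField f) 2 := by
  rw [memℓp_gen_iff (by norm_num)]
  refine ((summable_diff_sq hΦ hf).mul_left 2⁻¹).congr fun p => ?_
  rw [show (2 : ENNReal).toReal = ((2 : ℕ) : ℝ) by norm_num, Real.rpow_natCast, norm_edgeField_sq]

/-- The covariant derivative on the finitely supported sections. -/
noncomputable def derivative [∀ x, FiniteDimensional ℂ (E x)] (Φ : G.Connection E)
    (hΦ : Φ.IsUnitary) : G.L2 E →ₗ.[ℂ] EdgeL2 E where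
  domain := finSupp G E
  toFun :=
    { toFun := fun f => ⟨Φ.edgeField (f : G.L2 E), memℓp_edgeField hΦ f.2⟩
      map_add' := fun f g => by
        refine lp.ext (funext fun p => ?_)
        change Φ.edgeField ((f : G.L2 E) + g) p =
          Φ.edgeField (f : G.L2 E) p + Φ.edgeField (g : G.L2 E) p
        simp only [edgeField, diff_add, smul_add]
      map_smul' := fun c f => by
        refine lp.ext (funext fun p => ?_)
        change Φ.edgeField (c • (f : G.L2 E)) p = c • Φ.edgeField (f : G.L2 E) p
        simp only [edgeField, diff_smul]
        rw [smul_comm] }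

/-- At each pair of vertices the edge field depends continuously on `f`, through at most two values.
So the identity "edge component = covariant difference" survives in the closure of the graph, and a
limit over `f = 0` must vanish. -/
theorem derivative_isClosable [∀ x, FiniteDimensional ℂ (E x)] (Φ : G.Connection E)
    (hΦ : Φ.IsUnitary) : (Φ.derivative hΦ).IsClosable := by
  refine ⟨(Φ.derivative hΦ).graph.topologicalClosure.toLinearPMap,
    (Submodule.toLinearPMap_graph_eq _ ?_).symm⟩
  rintro ⟨f, w⟩ hfw hf
  simp only at hf ⊢
  subst hf
  have hcl : IsClosed {q : G.L2 E × EdgeL2 E | ∀ p, q.2 p = Φ.edgeField q.1 p} := by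
    rw [Set.ofPred_forall]
    refine isClosed_iInter fun p =>
      isClosed_eq ((lp.continuous_apply_two p).comp continuous_snd) ?_
    exact ((Φ.continuous_diff p.1 p.2).comp continuous_fst).const_smul _
  have hsub : ((Φ.derivative hΦ).graph : Set (G.L2 E × EdgeL2 E)) ⊆
      {q | ∀ p, q.2 p = Φ.edgeField q.1 p} := by
    rintro ⟨g, v⟩ hg p
    obtain ⟨u, rfl, rfl⟩ := (LinearPMap.mem_graph_iff _).mp hg
    rfl
  have h := closure_minimal hsub hcl hfw
  refine lp.ext (funext fun p => (h p).trans ?_)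
  have h0 : Φ.diff (0 : G.L2 E) p.1 p.2 = 0 := by
    simpa using Φ.diff_smul 0 (0 : G.L2 E) p.1 p.2
  rw [edgeField, h0, smul_zero]
  rfl

/-- The factor `√(b / 2)` in `edgeField` absorbs both the edge weight and the `1/2` in front of the
sum over ordered pairs. -/
theorem covariantForm_eq [∀ x, FiniteDimensional ℂ (E x)] (Φ : G.Connection E)
    (hΦ : Φ.IsUnitary) : Φ.covariantForm hΦ = NonnegForm.ofLinearPMap (Φ.derivative hΦ) := by
  have h : ∀ f g : finSupp G E, Φ.covariantSum (f : G.L2 E) g =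
      inner ℂ (Φ.derivative hΦ f) (Φ.derivative hΦ g) := by
    intro f g
    rw [covariantSum, ← tsum_mul_left, lp.inner_eq_tsum]
    refine tsum_congr fun p => ?_
    change _ = inner ℂ (Φ.edgeField (f : G.L2 E) p) (Φ.edgeField (g : G.L2 E) p)
    rw [edgeField, edgeField, inner_smul_left, inner_smul_right, Complex.conj_ofReal, ← mul_assoc,
      ← mul_assoc, ← Complex.ofReal_mul, Real.mul_self_sqrt
        (div_nonneg (G.b_nonneg p.1 p.2) zero_le_two)]
    push_cast
    ring
  unfold covariantForm NonnegForm.ofLinearPMap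
  congr 1
  exact LinearMap.ext₂ h

/-- The covariant form is closable. -/
theorem covariantForm_closure_isClosure [∀ x, FiniteDimensional ℂ (E x)] (Φ : G.Connection E)
    (hΦ : Φ.IsUnitary) : (Φ.covariantForm hΦ).closure.IsClosure (Φ.covariantForm hΦ) := by
  have hc : ∀ x, CompleteSpace (E x) := fun x => FiniteDimensional.complete ℂ (E x)
  rw [covariantForm_eq]
  exact NonnegForm.closure_isClosure
    (NonnegForm.isClosure_ofLinearPMap_closure (Φ.derivative_isClosable hΦ))

theorem schrodingerForm_isClosed [∀ x, FiniteDimensional ℂ (E x)] (Φ : G.Connection E)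
    (hΦ : Φ.IsUnitary) (V : ∀ x, E x →L[ℂ] E x) (hV : ∀ x, (V x).IsPositive) :
    (Φ.schrodingerForm hΦ V hV).IsClosed :=
  (Φ.covariantForm_closure_isClosure hΦ).1.add (potentialForm_isClosed V hV)

theorem dense_schrodingerForm_domain [∀ x, FiniteDimensional ℂ (E x)] (Φ : G.Connection E)
    (hΦ : Φ.IsUnitary) (V : ∀ x, E x →L[ℂ] E x) (hV : ∀ x, (V x).IsPositive) :
    Dense ((Φ.schrodingerForm hΦ V hV).domain : Set (G.L2 E)) := by
  obtain ⟨-, hle, -⟩ := Φ.covariantForm_closure_isClosure hΦ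
  exact dense_finSupp.mono fun f hf => ⟨hle hf, finSupp_le_potentialDomain V hV hf⟩

end Connection

/-! ### Compact multiplication operators -/

/-- Multiplication by a section of `End(E)` tending to zero at infinity is an everywhere defined
compact operator. -/
theorem exists_compact_mulOp [∀ x, FiniteDimensional ℂ (E x)] {W : ∀ x, E x →L[ℂ] E x}
    (hW : ∀ c : ℝ, 0 < c → {x | c < ‖W x‖}.Finite) :
    (G.mulOp W).domain = ⊤ ∧ ∃ T : G.L2 E →L[ℂ] G.L2 E,
      (∀ f (h : f ∈ (G.mulOp W).domain), T f = G.mulOp W ⟨f, h⟩) ∧ IsCompactOperator T := by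
  -- Only finitely many norms exceed 1, so the larger of their bound and 1 bounds all of them.
  obtain ⟨C₀, hC₀⟩ := ((hW 1 one_pos).image fun x => ‖W x‖).bddAbove
  have hC : ∀ x, ‖W x‖ ≤ max C₀ 1 := by
    intro x
    by_cases hx : 1 < ‖W x‖
    · exact le_max_of_le_left (hC₀ ⟨x, hx, rfl⟩)
    · exact le_max_of_le_right (not_lt.mp hx)
  have htop := mulOp_domain_eq_top (G := G) hC
  have hmem : ∀ f, f ∈ (G.mulOp W).domain := fun f => htop ▸ Submodule.mem_top
  let T : G.L2 E →L[ℂ] G.L2 E := LinearMap.mkContinuous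
    { toFun := fun f => G.mulOp W ⟨f, hmem f⟩
      map_add' := fun f g => (G.mulOp W).map_add ⟨f, hmem f⟩ ⟨g, hmem g⟩
      map_smul' := fun c f => (G.mulOp W).map_smul c ⟨f, hmem f⟩ } (max C₀ 1) fun f => by
    have h := lp.norm_mono two_ne_zero (x := G.mulOp W ⟨f, hmem f⟩)
      (norm_mulOp_apply_le (G := G) hC f)
    rwa [norm_smul, Complex.norm_real, Real.norm_of_nonneg (by positivity)] at h
  refine ⟨htop, T, fun f h => rfl, ?_⟩
  refine lp.isCompactOperator_of_diagonal (fun x => G.fiberMap x (W x)) T (fun f x => rfl)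
    fun c hc => (hW c hc).subset fun x hx => lt_of_lt_of_le hx (norm_fiberMap_le x (W x))

end WeightedGraph

/-! ### Finiteness from summability, and the theorem -/

theorem Summable.finite_lt_norm {ι : Type*} {F : ι → Type*} [∀ i, NormedAddCommGroup (F i)]
    {A : ∀ i, F i} (hA : Summable fun i => ‖A i‖ ^ 2) {c : ℝ} (hc : 0 < c) :
    {i | c < ‖A i‖}.Finite := by
  have h := hA.tendsto_cofinite_zero.eventually_lt_const (show 0 < c ^ 2 by positivity)
  refine (eventually_cofinite.mp h).subset fun i hi => ?_
  exact not_lt.mpr (pow_le_pow_left₀ hc.le (le_of_lt hi) 2)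

/-- Terms of a convergent series tend to zero along the cofinite filter, so only finitely many can
be at least 1. -/
theorem Summable.finite_of_one_le {ι : Type*} {g : ι → ℝ} (hg : Summable g) (h1 : ∀ i, 1 ≤ g i) :
    Finite ι := by
  have h := hg.tendsto_cofinite_zero.eventually_lt_const one_pos
  rw [eventually_cofinite] at h
  exact Set.finite_univ_iff.mp (h.subset fun i _ => not_lt.mpr (h1 i))

theorem mainTheorem8 {X : Type*} [Countable X] (G : WeightedGraph X) (hG : G.Connected)
    (d : ℕ) (E : X → Type*) [∀ x, NormedAddCommGroup (E x)] [∀ x, InnerProductSpace ℂ (E x)]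
    [∀ x, FiniteDimensional ℂ (E x)] (hd : ∀ x, Module.finrank ℂ (E x) = d)
    (Φ : G.Connection E) (hΦ : Φ.IsUnitary)
    (V : ∀ x, E x →L[ℂ] E x) (hV : ∀ x, (V x).IsPositive)
    (W W₁ W₂ : ∀ x, E x →L[ℂ] E x) (hW : ∀ x, W x = W₁ x + W₂ x)
    (hW₁ : ∀ x, (W₁ x).IsSymmetric) (hW₂ : ∀ x, (W₂ x).IsSymmetric)
    (hsum₁ : Summable fun x => ‖W₁ x‖ ^ 2)
    (hsum₂ : ∀ c : ℝ, 0 < c → Summable fun x : {x : X // c < ‖W₂ x‖} => 1 + G.ρ x) :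
    -- the covariant form is closable, and the Schrödinger operator is self-adjoint
    (Φ.covariantForm hΦ).closure.IsClosure (Φ.covariantForm hΦ) ∧
    IsSelfAdjoint (Φ.schrodinger hΦ V hV) ∧
    ∀ a : ℝ, 0 < a → ∃ R : G.L2 E →L[ℂ] G.L2 E,
      IsBoundedInverseOfAdd (Φ.schrodinger hΦ V hV) a R ∧
      ∃ hdom : ∀ f, R f ∈ (G.mulOp W).domain,
        ∃ K : G.L2 E →L[ℂ] G.L2 E, (∀ f, K f = G.mulOp W ⟨R f, hdom f⟩) ∧
          IsCompactOperator K := by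
  have hq := Φ.schrodingerForm_isClosed hΦ V hV
  have hdense := Φ.dense_schrodingerForm_domain hΦ V hV
  refine ⟨Φ.covariantForm_closure_isClosure hΦ, NonnegForm.isSelfAdjoint_operator hq hdense,
    fun a ha => ?_⟩
  obtain ⟨R, hR⟩ := NonnegForm.exists_isBoundedInverseOfAdd hq hdense ha
  have hfin : ∀ c : ℝ, 0 < c → {x | c < ‖W x‖}.Finite := by
    intro c hc
    -- If `c < |W₁ + W₂|`, then one of the two norms exceeds `c / 2`. For `W₂`, positivity of `ρ`
    -- makes the summands `1 + ρ` at least 1.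
    have h₂ : {x | c / 2 < ‖W₂ x‖}.Finite := Set.finite_coe_iff.mp
      ((hsum₂ (c / 2) (half_pos hc)).finite_of_one_le fun x => by linarith [G.ρ_pos x])
    refine ((hsum₁.finite_lt_norm (half_pos hc)).union h₂).subset fun x hx => ?_
    by_contra h
    simp only [Set.mem_union, Set.mem_ofPred_eq, not_or, not_lt] at h hx
    rw [hW] at hx
    linarith [norm_add_le (W₁ x) (W₂ x), h.1, h.2]
  obtain ⟨htop, T, hT, hcomp⟩ := WeightedGraph.exists_compact_mulOp (G := G) hfin
  have hdom : ∀ f, R f ∈ (G.mulOp W).domain := fun f => htop ▸ Submodule.mem_top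
  exact ⟨R, hR, hdom, T ∘L R, fun f => hT _ _, hcomp.comp_clm R⟩
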